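/- Let $T$ be a triangulation of a square with $n$ triangles, that is, a finite oriented simplicial complex $T$ with $n$ triangles $\Delta_1,\dots,\Delta_n$, homeomorphic to a closed disk, with exactly four boundary vertices (the corners) $\mathbf p,\mathbf q,\mathbf r,\mathbf s$, labelled in the cyclic order determined by the orientation; the other vertices are called interior. The area of an ordered triangle with vertices $(x_1,y_1),(x_2,y_2),(x_3,y_3)$ over a field of characteristic $\neq 2$ is $\frac12\det\begin{pmatrix}1&1&1\\x_1&x_2&x_3\\y_1&y_2&y_3\end{pmatrix}$. Let $S$ be the field of rational functions over $\mathbb Q$ in the variables $x_v,y_v$, where $v$ runs over the vertices of $T$ other than $\mathbf r$; put $x_{\mathbf r}=x_{\mathbf q}+x_{\mathbf s}-x_{\mathbf p}$ and $y_{\mathbf r}=y_{\mathbf q}+y_{\mathbf s}-y_{\mathbf p}$ in $S$. Let $Z_j\in S$ be the area of $\Delta_j$ when every vertex $v$ is placed at $(x_v,y_v)$, and let $\sigma=\sum_j Z_j$. A polynomial $f\in\mathbb Z[A_1,\dots,A_n]$ is a Monsky polynomial for $T$ if it is homogeneous and $2f(Z_1,\dots,Z_n)=\sigma^e$ in $S$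 for some integer $e\ge 0$. Let $\tilde S$ (the fixed-corner function field) be the field of rational functions over $\mathbb Q$ in the variables $\tilde X_v,\tilde Y_v$, where $v$ runs over the interior vertices; put $(\tilde X_{\mathbf p},\tilde Y_{\mathbf p})=(0,0)$, $(\tilde X_{\mathbf q},\tilde Y_{\mathbf q})=(1,0)$, $(\tilde X_{\mathbf r},\tilde Y_{\mathbf r})=(1,1)$, $(\tilde X_{\mathbf s},\tilde Y_{\mathbf s})=(0,1)$. Let $\tilde Z_j\in\tilde S$ be the area of $\Delta_j$ when every vertex $v$ is placed at $(\tilde X_v,\tilde Y_v)$. Then: (1) there is a homogeneous polynomial $f$ with integer coefficients in $n$ variables such that $2f(\tilde Z_1,\dots,\tilde Z_n)=1$ in $\tilde S$; (2) every Monsky polynomial $f$ for $T$ satisfies $2f(\tilde Z_1,\dots,\tilde Z_n)=1$ in $\tilde S$; (3) conversely, every homogeneous polynomial $f$ of degree $e$ with integer coefficients that satisfies $2f(\tilde Z_1,\dots,\tilde Z_n)=1$ in $\tilde S$ is a Monsky polynomial for $T$, and in fact satisfies $2f(Z_1,\dots,Z_n)=\sigma^e$ in $S$. -/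

import Mathlib

noncomputable section

/-- The geometric realization of a finite abstract simplicial complex: the points of `ℝ^V` whose
barycentric coordinates are nonnegative, add up to `1` and are supported on a face
(with the topology of a subspace of `ℝ^V`). -/
def AbstractSimplicialComplex.realization {V : Type*} [Fintype V]
    (K : AbstractSimplicialComplex V) : Set (V → ℝ) :=
  {w | (∀ v, 0 ≤ w v) ∧ ∑ v, w v = 1 ∧ ∃ s ∈ K.faces, ∀ v, w v ≠ 0 → v ∈ s}

/-- A triangulation of a square with vertex set `V` and `n` triangles: an oriented simplicial
complex homeomorphic to a closed disk, with exactly four boundary vertices `p, q, r, s`, labelled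
in the cyclic order determined by the orientation.

The triangles are listed as `tri 0, …, tri (n - 1)`. Each one is an ordered triple of vertices,
which represents its orientation; the directed edges of triangle `j` are
`(tri j i, tri j (i + 1))`, where `i + 1` is computed in `Fin 3`, that is, modulo `3`. -/
structure SquareTriangulation (V : Type*) [Fintype V] (n : ℕ) where
  /-- The underlying simplicial complex. -/
  complex : AbstractSimplicialComplex V
  /-- The complex is homeomorphic to the closed unit disk. -/
  homeomorphic_disk :
    Nonempty (complex.realization ≃ₜ Metric.closedBall (0 : EuclideanSpace ℝ (Fin 2)) 1)
  /-- The oriented triangles. -/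
  tri : Fin n → Fin 3 → V
  tri_injective : ∀ j, Function.Injective (tri j)
  /-- The triangles `tri j` are precisely the 2-dimensional faces, without repetition. -/
  tri_bijOn : Set.BijOn
    (fun j => Finset.univ.map ⟨tri j, tri_injective j⟩) Set.univ {t ∈ complex.faces | t.card = 3}
  /-- The orientations are coherent: two distinct triangles that share an edge induce opposite
  directions on it. -/
  coherent : ∀ j j' i i', tri j i = tri j' i' → tri j (i + 1) = tri j' (i' + 1) → j = j'
  /-- The corners `p, q, r, s`, in this order. -/
  corner : Fin 4 → V
  corner_injective : Function.Injective corner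
  /-- The boundary edges (the edges that lie in only one triangle), with the direction induced by
  the orientation, are `pq`, `qr`, `rs` and `sp`. -/
  boundary : ∀ a b : V,
    ((∃ j i, tri j i = a ∧ tri j (i + 1) = b) ∧ ¬ ∃ j i, tri j i = b ∧ tri j (i + 1) = a) ↔
      ∃ i : Fin 4, a = corner i ∧ b = corner (i + 1)

/-- The (signed) area of an ordered triangle in the affine plane `F²`. -/
def triangleArea {F : Type*} [Field F] (P : Fin 3 → Fin 2 → F) : F :=
  1 / 2 * Matrix.det !![1, 1, 1;
                        P 0 0, P 1 0, P 2 0;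
                        P 0 1, P 1 1, P 2 1]

namespace SquareTriangulation

variable {V : Type*} [Fintype V] {n : ℕ} (T : SquareTriangulation V n)

/-- The corner `p`. -/
abbrev p : V := T.corner 0
/-- The corner `q`. -/
abbrev q : V := T.corner 1
/-- The corner `r`. -/
abbrev r : V := T.corner 2
/-- The corner `s`. -/
abbrev s : V := T.corner 3

theorem p_ne_r : T.p ≠ T.r := T.corner_injective.ne (by decide)
theorem q_ne_r : T.q ≠ T.r := T.corner_injective.ne (by decide)
theorem s_ne_r : T.s ≠ T.r := T.corner_injective.ne (by decide)

/-! ### The coordinate function field of the drawing space -/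

/-- The coordinate function field `S`: rational functions over `ℚ` in the variables
`x_v` (index `(v, 0)`) and `y_v` (index `(v, 1)`), where `v` runs over the vertices other than
`r`. -/
abbrev FunctionField : Type _ :=
  FractionRing (MvPolynomial ({v : V // v ≠ T.r} × Fin 2) ℚ)

/-- The variable `x_v` or `y_v` of `S`. -/
def coordVar (v : {v : V // v ≠ T.r}) (i : Fin 2) : T.FunctionField :=
  algebraMap (MvPolynomial ({v : V // v ≠ T.r} × Fin 2) ℚ) T.FunctionField (MvPolynomial.X (v, i))

open Classical in
/-- The coordinates `(x_v, y_v)` in `S` of all the vertices, where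
`x_r = x_q + x_s - x_p` and `y_r = y_q + y_s - y_p`. -/
def coord (v : V) (i : Fin 2) : T.FunctionField :=
  if h : v ≠ T.r then T.coordVar ⟨v, h⟩ i
  else T.coordVar ⟨T.q, T.q_ne_r⟩ i + T.coordVar ⟨T.s, T.s_ne_r⟩ i - T.coordVar ⟨T.p, T.p_ne_r⟩ i

/-- `Z_j`, the area of the `j`-th triangle, as an element of `S`. -/
def Z (j : Fin n) : T.FunctionField := triangleArea fun i => T.coord (T.tri j i)

/-- `σ`, the sum of the areas `Z_j`. -/
def σ : T.FunctionField := ∑ j, T.Z j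

/-- `f` is a Monsky polynomial for `T`: a homogeneous polynomial with integer coefficients such
that `2 f(Z_1, …, Z_n) = σ ^ e` in `S` for some `e ≥ 0`. -/
def IsMonskyPolynomial (f : MvPolynomial (Fin n) ℤ) : Prop :=
  (∃ d : ℕ, f.IsHomogeneous d) ∧ ∃ e : ℕ, 2 * MvPolynomial.aeval T.Z f = T.σ ^ e

/-! ### The fixed-corner function field -/

/-- An interior vertex is a vertex that is not a corner. -/
abbrev InteriorVertex : Type _ := {v : V // v ∉ Set.range T.corner}

/-- The fixed-corner function field: rational functions over `ℚ` in the variables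
`X_v` (index `(v, 0)`) and `Y_v` (index `(v, 1)`), where `v` runs over the interior vertices. -/
abbrev FixedCornerField : Type _ :=
  FractionRing (MvPolynomial (T.InteriorVertex × Fin 2) ℚ)

open Classical in
/-- The coordinates in the fixed-corner function field of all the vertices; the corners are
`p = (0, 0)`, `q = (1, 0)`, `r = (1, 1)` and `s = (0, 1)`. -/
def fixedCoord (v : V) : Fin 2 → T.FixedCornerField :=
  if h : v ∉ Set.range T.corner then
    fun i => algebraMap (MvPolynomial (T.InteriorVertex × Fin 2) ℚ) T.FixedCornerField
      (MvPolynomial.X (⟨v, h⟩, i))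
  else if v = T.p then ![0, 0]
  else if v = T.q then ![1, 0]
  else if v = T.r then ![1, 1]
  else ![0, 1] -- here `v = s`

/-- The area of the `j`-th triangle, as an element of the fixed-corner function field. -/
def fixedZ (j : Fin n) : T.FixedCornerField := triangleArea fun i => T.fixedCoord (T.tri j i)

end SquareTriangulation

end

/-! Existence is Monsky's argument applied to the ring `A` generated by the fixed-corner areas. If 2
were not a unit of `A`, a valuation ring would contain `A` with 2 in its maximal ideal. Colouring
the plane by its valuation and counting edges as in Sperner's lemma yields a rainbow triangle; its
doubled area has valuation at least 1, yet its area lies in `A` and `v 2 < 1`. So 2 has an inverse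
that is an integer polynomial in the areas, and this polynomial can be homogenized because the areas
sum to 1. The other claims compare the two fields. Placing the generic corners at the unit square
sends `σ` to 1 (`two_mul_aeval_fixedZ`). Conversely, the affine map normalizing the generic corners
divides every area by `σ`, and homogeneity collects these factors into `σ ^ e` (`two_mul_aeval_Z`).
-/

/-- The determinant of two plane vectors. -/
def planeCross {R : Type*} [CommRing R] (a b : Fin 2 → R) : R := a 0 * b 1 - a 1 * b 0

theorem planeCross_neg_swap {R : Type*} [CommRing R] (a b : Fin 2 → R) :
    planeCross b a = -planeCross a b := by
  unfold planeCross; ring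

theorem planeCross_self {R : Type*} [CommRing R] (a : Fin 2 → R) : planeCross a a = 0 := by
  unfold planeCross; ring

theorem planeCross_add_self {R : Type*} [CommRing R] (a b : Fin 2 → R) :
    planeCross (a + b) b = planeCross a b := by
  simp only [planeCross, Pi.add_apply]; ring

theorem planeCross_self_add {R : Type*} [CommRing R] (a b : Fin 2 → R) :
    planeCross a (a + b) = planeCross a b := by
  simp only [planeCross, Pi.add_apply]; ring

theorem triangleArea_eq {F : Type*} [Field F] (P : Fin 3 → Fin 2 → F) :
    triangleArea P = 1 / 2 * ∑ i, planeCross (P i) (P (i + 1)) := by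
  rw [triangleArea, Matrix.det_fin_three]
  simp only [Fin.sum_univ_three, planeCross, Fin.isValue, zero_add, Fin.reduceAdd, Matrix.of_apply,
    Matrix.cons_val]
  ring

theorem two_mul_triangleArea {F : Type*} [Field F] [CharZero F] (P : Fin 3 → Fin 2 → F) :
    2 * triangleArea P =
      (P 1 0 - P 0 0) * (P 2 1 - P 0 1) - (P 1 1 - P 0 1) * (P 2 0 - P 0 0) := by
  rw [triangleArea_eq]
  simp only [Fin.sum_univ_three, planeCross, Fin.isValue, zero_add, Fin.reduceAdd]
  ring

/-- The area of the image of a triangle under a homomorphism to a field is the image of a fixed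
element of the source ring. -/
theorem triangleArea_map {A F : Type*} [CommRing A] [Algebra ℚ A] [Field F] (g : A →+* F)
    (P : Fin 3 → Fin 2 → A) :
    triangleArea (fun i k => g (P i k)) =
      g (algebraMap ℚ A (1 / 2) * ∑ i, planeCross (P i) (P (i + 1))) := by
  have h : g (algebraMap ℚ A (1 / 2)) = 1 / 2 := by
    rw [← RingHom.comp_apply, map_div₀, map_one, map_ofNat]
  rw [triangleArea_eq, map_mul, h]
  simp [planeCross]

/-! ### Monsky's colouring -/

section Coloring

variable {F Γ : Type*} [Field F] [LinearOrderedCommGroupWithZero Γ] (v : Valuation F Γ)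

open Classical in
/-- Monsky's colouring of the plane by means of a valuation. -/
noncomputable def monskyColor (a : Fin 2 → F) : Fin 3 :=
  if v (a 0) < 1 ∧ v (a 1) < 1 then 0
  else if v (a 1) ≤ v (a 0) then 1
  else 2

theorem monskyColor_eq_zero {a : Fin 2 → F} (h : monskyColor v a = 0) :
    v (a 0) < 1 ∧ v (a 1) < 1 := by
  unfold monskyColor at h
  split_ifs at h with h1 h2 <;> simp_all

theorem monskyColor_eq_one {a : Fin 2 → F} (h : monskyColor v a = 1) :
    1 ≤ v (a 0) ∧ v (a 1) ≤ v (a 0) := by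
  unfold monskyColor at h
  split_ifs at h with h1 h2
  · simp at h
  · refine ⟨?_, h2⟩
    by_contra hlt
    exact h1 ⟨not_le.1 hlt, h2.trans_lt (not_le.1 hlt)⟩
  · simp at h

theorem monskyColor_eq_two {a : Fin 2 → F} (h : monskyColor v a = 2) :
    1 ≤ v (a 1) ∧ v (a 0) < v (a 1) := by
  unfold monskyColor at h
  split_ifs at h with h1 h2
  · simp at h
  · simp at h
  · rw [not_le] at h2
    refine ⟨?_, h2⟩
    by_contra hlt
    exact h1 ⟨h2.trans (not_le.1 hlt), not_le.1 hlt⟩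

/-- Subtracting the colour-0 point does not change the valuation of `b 0` or `c 1`, so the product
of these two terms strictly dominates the determinant. -/
theorem one_le_valuation_of_monskyColor {a b c : Fin 2 → F} (ha : monskyColor v a = 0)
    (hb : monskyColor v b = 1) (hc : monskyColor v c = 2) :
    1 ≤ v ((b 0 - a 0) * (c 1 - a 1) - (b 1 - a 1) * (c 0 - a 0)) := by
  obtain ⟨ha0, ha1⟩ := monskyColor_eq_zero v ha
  obtain ⟨hb0, hb1⟩ := monskyColor_eq_one v hb
  obtain ⟨hc0, hc1⟩ := monskyColor_eq_two v hc
  have h1 : v (b 0 - a 0) = v (b 0) := v.map_sub_eq_of_lt_left (ha0.trans_le hb0)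
  have h2 : v (c 1 - a 1) = v (c 1) := v.map_sub_eq_of_lt_left (ha1.trans_le hc0)
  have h3 : v (b 1 - a 1) ≤ v (b 0) := v.map_sub_le hb1 (ha1.le.trans hb0)
  have h4 : v (c 0 - a 0) < v (c 1) := v.map_sub_lt hc1 (ha0.trans_le hc0)
  have hlt : v ((b 1 - a 1) * (c 0 - a 0)) < v ((b 0 - a 0) * (c 1 - a 1)) := by
    rw [map_mul, map_mul, h1, h2]
    exact (mul_le_mul_left h3 _).trans_lt
      (mul_lt_mul_of_pos_left h4 (zero_lt_one.trans_le hb0))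
  rw [v.map_sub_eq_of_lt_left hlt, map_mul, h1, h2]
  exact one_le_mul hb0 hc0

/-- The alternating weight of a directed edge that counts the edges from colour `0` to
colour `1`. -/
def edgeWeight (a b : Fin 3) : ℤ :=
  if a = 0 ∧ b = 1 then 1 else if a = 1 ∧ b = 0 then -1 else 0

theorem edgeWeight_swap : ∀ a b : Fin 3, edgeWeight b a = -edgeWeight a b := by decide

/-- Around a triangle that misses a colour, steps from 0 to 1 and from 1 to 0 cancel. -/
theorem rainbow_of_edgeWeight_sum_ne_zero : ∀ a b c : Fin 3,
    edgeWeight a b + edgeWeight b c + edgeWeight c a ≠ 0 →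
      (a = 0 ∧ b = 1 ∧ c = 2) ∨ (a = 0 ∧ b = 2 ∧ c = 1) ∨ (a = 1 ∧ b = 0 ∧ c = 2) ∨
      (a = 1 ∧ b = 2 ∧ c = 0) ∨ (a = 2 ∧ b = 0 ∧ c = 1) ∨ (a = 2 ∧ b = 1 ∧ c = 0) := by
  decide

theorem one_le_valuation_two_mul_triangleArea [CharZero F] (P : Fin 3 → Fin 2 → F)
    (h : ∑ i, edgeWeight (monskyColor v (P i)) (monskyColor v (P (i + 1))) ≠ 0) :
    1 ≤ v (2 * triangleArea P) := by
  simp only [Fin.sum_univ_three, Fin.isValue, zero_add, Fin.reduceAdd] at h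
  rw [two_mul_triangleArea]
  rcases rainbow_of_edgeWeight_sum_ne_zero _ _ _ h with
    ⟨h0, h1, h2⟩ | ⟨h0, h1, h2⟩ | ⟨h0, h1, h2⟩ | ⟨h0, h1, h2⟩ | ⟨h0, h1, h2⟩ | ⟨h0, h1, h2⟩
  · exact one_le_valuation_of_monskyColor v h0 h1 h2
  · convert one_le_valuation_of_monskyColor v h0 h2 h1 using 1
    rw [← v.map_neg]; congr 1; ring
  · convert one_le_valuation_of_monskyColor v h1 h0 h2 using 1
    rw [← v.map_neg]; congr 1; ring
  · convert one_le_valuation_of_monskyColor v h2 h0 h1 using 1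
    congr 1; ring
  · convert one_le_valuation_of_monskyColor v h1 h2 h0 using 1
    congr 1; ring
  · convert one_le_valuation_of_monskyColor v h2 h1 h0 using 1
    rw [← v.map_neg]; congr 1; ring

end Coloring

/-! ### Homogenization -/

namespace MvPolynomial

/-- If the sum of the coordinates of a point is `1`, then every value at that point of a polynomial
is a value of a homogeneous polynomial. -/
theorem exists_isHomogeneous_aeval_eq {ι R A : Type*} [Fintype ι] [CommRing R] [CommRing A]
    [Algebra R A] (z : ι → A) (hz : ∑ i, z i = 1) (f : MvPolynomial ι R) :
    ∃ g : MvPolynomial ι R, g.IsHomogeneous f.totalDegree ∧ aeval z g = aeval z f := by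
  -- Each component is padded to full degree by a power of the sum of the variables, which evaluates
  -- to 1.
  refine ⟨∑ k ∈ Finset.range (f.totalDegree + 1),
    homogeneousComponent k f * (∑ i, X i) ^ (f.totalDegree - k), ?_, ?_⟩
  · refine IsHomogeneous.sum _ _ _ fun k hk => ?_
    have hX : (∑ i, X i : MvPolynomial ι R).IsHomogeneous 1 :=
      IsHomogeneous.sum _ _ _ fun i _ => isHomogeneous_X R i
    have := (homogeneousComponent_isHomogeneous k f).mul (hX.pow (f.totalDegree - k))
    rwa [one_mul, Nat.add_sub_cancel' (Nat.lt_succ_iff.1 (Finset.mem_range.1 hk))] at this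
  · conv_rhs => rw [← sum_homogeneousComponent f]
    simp [hz]

theorem IsHomogeneous.aeval_mul_left {ι R A : Type*} [CommRing R] [CommRing A]
    [Algebra R A] {f : MvPolynomial ι R} {e : ℕ} (hf : f.IsHomogeneous e) (c : A) (z : ι → A) :
    MvPolynomial.aeval (fun i => c * z i) f = c ^ e * MvPolynomial.aeval z f := by
  rw [aeval_def, aeval_def, eval₂_eq, eval₂_eq, Finset.mul_sum]
  refine Finset.sum_congr rfl fun d hd => ?_
  have hdeg : ∑ i ∈ d.support, d i = e := by
    simpa [Finsupp.weight_apply, Finsupp.sum] using hf (mem_support_iff.1 hd)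
  simp_rw [mul_pow]
  rw [Finset.prod_mul_distrib, Finset.prod_pow_eq_pow_sum, hdeg]
  ring

end MvPolynomial

namespace SquareTriangulation

variable {V : Type*} [Fintype V] {n : ℕ} (T : SquareTriangulation V n)

/-! ### Summation over the edges of the triangles -/

/-- The sum of an alternating function over the directed edges of all the triangles is its sum over
the boundary edges. -/
theorem sum_edges {M : Type*} [AddCommGroup M] [IsAddTorsionFree M] (φ : V → V → M)
    (hφ : ∀ a b, φ b a = -φ a b) :
    ∑ j, ∑ i, φ (T.tri j i) (T.tri j (i + 1)) =
      ∑ i, φ (T.corner i) (T.corner (i + 1)) := by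
  classical
  let d : Fin n × Fin 3 → V × V := fun x => (T.tri x.1 x.2, T.tri x.1 (x.2 + 1))
  -- By coherence a directed edge occurs only once, so the edges form a set without multiplicities.
  have hd : Function.Injective d := by
    rintro ⟨j, i⟩ ⟨j', i'⟩ h
    obtain ⟨h1, h2⟩ := Prod.mk.inj h
    obtain rfl : j = j' := T.coherent _ _ _ _ h1 h2
    exact congrArg (Prod.mk j) (T.tri_injective j h1)
  let E : Finset (V × V) := Finset.univ.map ⟨d, hd⟩
  have hE : ∀ a b, (a, b) ∈ E ↔ ∃ j i, T.tri j i = a ∧ T.tri j (i + 1) = b := by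
    intro a b
    simp [E, d]
  have hsum : ∑ j, ∑ i, φ (T.tri j i) (T.tri j (i + 1)) = ∑ x ∈ E, φ x.1 x.2 := by
    rw [Finset.sum_map, ← Finset.univ_product_univ, Finset.sum_product]
    rfl
  -- Interior edges occur in both directions; reversal equates their sum with its negative.
  have hsymm : ∑ x ∈ E with x.swap ∈ E, φ x.1 x.2 = 0 := by
    rw [← self_eq_neg, ← Finset.sum_neg_distrib]
    refine Finset.sum_bij' (fun x _ => x.swap) (fun x _ => x.swap) ?_ ?_ ?_ ?_ ?_
    · intro x hx
      simpa [and_comm] using hx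
    · intro x hx
      simpa [and_comm] using hx
    · simp
    · simp
    · intro x _
      rw [← hφ]; rfl
  rw [hsum, ← Finset.sum_filter_add_sum_filter_not E (fun x => x.swap ∈ E), hsymm, zero_add]
  have hc : Function.Injective fun i => (T.corner i, T.corner (i + 1)) :=
    fun i i' h => T.corner_injective (Prod.mk.inj h).1
  have hb : (E.filter fun x => x.swap ∉ E) = Finset.univ.map ⟨_, hc⟩ := by
    ext ⟨a, b⟩
    rw [Finset.mem_filter, Prod.swap_prod_mk, hE, hE, T.boundary]
    simp [eq_comm]
  rw [hb, Finset.sum_map]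
  rfl

theorem sum_triangleArea {F : Type*} [Field F] [CharZero F] (P : V → Fin 2 → F) :
    ∑ j, triangleArea (fun i => P (T.tri j i)) =
      1 / 2 * ∑ i, planeCross (P (T.corner i)) (P (T.corner (i + 1))) := by
  have : IsAddTorsionFree F := inferInstance
  rw [← T.sum_edges (fun a b => planeCross (P a) (P b)) fun a b => planeCross_neg_swap _ _,
    Finset.mul_sum]
  simp_rw [triangleArea_eq]

section UnitSquare

variable {F : Type*} [Field F] [CharZero F] {P : V → Fin 2 → F} (hp : P T.p = ![0, 0])
  (hq : P T.q = ![1, 0]) (hr : P T.r = ![1, 1]) (hs : P T.s = ![0, 1])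

include hp hq hr hs

theorem sum_triangleArea_eq_one : ∑ j, triangleArea (fun i => P (T.tri j i)) = 1 := by
  rw [T.sum_triangleArea]
  simp [Fin.sum_univ_four, hp, hq, hr, hs, planeCross]
  norm_num

/-- Monsky's theorem for a valuation: some triangle is rainbow, so that the double of its area is
not small. -/
theorem exists_one_le_valuation {Γ : Type*} [LinearOrderedCommGroupWithZero Γ]
    (v : Valuation F Γ) : ∃ j, 1 ≤ v (2 * triangleArea fun i => P (T.tri j i)) := by
  have hsum : ∑ j, ∑ i, edgeWeight (monskyColor v (P (T.tri j i)))
      (monskyColor v (P (T.tri j (i + 1)))) ≠ 0 := by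
    rw [T.sum_edges (fun a b => edgeWeight (monskyColor v (P a)) (monskyColor v (P b)))
      fun a b => edgeWeight_swap _ _]
    -- The corners have colours 0, 1, 1, 2, so only `pq` contributes, with weight 1.
    simp [Fin.sum_univ_four, hp, hq, hr, hs, monskyColor, edgeWeight]
  obtain ⟨j, -, hj⟩ := Finset.exists_ne_zero_of_sum_ne_zero hsum
  exact ⟨j, one_le_valuation_two_mul_triangleArea v _ hj⟩

theorem isUnit_two_of_triangleArea_mem (A : Subring F)
    (hA : ∀ j, triangleArea (fun i => P (T.tri j i)) ∈ A) : IsUnit (2 : A) := by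
  by_contra h2
  -- A proper ideal of a subring of a field lies in the nonunits of some valuation ring containing
  -- the subring.
  obtain ⟨B, hAB, hB⟩ := Ideal.image_subset_nonunits_valuationSubring (Ideal.span {(2 : A)})
    (by rwa [Ne, Ideal.span_singleton_eq_top])
  have hv2 : B.valuation 2 < 1 :=
    B.mem_nonunits_iff.1 (hB ⟨2, Ideal.mem_span_singleton_self _, rfl⟩)
  obtain ⟨j, hj⟩ := T.exists_one_le_valuation hp hq hr hs B.valuation
  rw [map_mul] at hj
  exact hj.not_gt (mul_lt_one_of_lt_of_le hv2
    ((B.valuation_le_one_iff _).2 (hAB (hA j))))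

theorem exists_isHomogeneous_two_mul_aeval_eq_one [algF : Algebra ℤ F] :
    ∃ (f : MvPolynomial (Fin n) ℤ) (e : ℕ), f.IsHomogeneous e ∧
      2 * MvPolynomial.aeval (fun j => triangleArea fun i => P (T.tri j i)) f = 1 := by
  obtain rfl : algF = Ring.toIntAlgebra F := Subsingleton.elim _ _
  set z : Fin n → F := fun j => triangleArea fun i => P (T.tri j i)
  obtain ⟨⟨x, g, hg⟩, hx⟩ := (T.isUnit_two_of_triangleArea_mem hp hq hr hs
    (MvPolynomial.aeval (R := ℤ) z).range.toSubring
    fun j => ⟨MvPolynomial.X j, MvPolynomial.aeval_X _ _⟩).exists_right_inv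
  obtain ⟨f, hf, hfg⟩ := MvPolynomial.exists_isHomogeneous_aeval_eq z
    (T.sum_triangleArea_eq_one hp hq hr hs) g
  refine ⟨f, _, hf, ?_⟩
  rw [hfg]
  exact (congrArg (2 * ·) hg).trans (congrArg Subtype.val hx)

end UnitSquare

/-! ### Transfer of identities between the function fields -/

/-- Identities between areas of generic triangles specialize. -/
theorem two_mul_aeval_transfer {A K L : Type*} [CommRing A] [Algebra ℚ A] [Field K] [Field L]
    [algK : Algebra ℤ K] [algL : Algebra ℤ L] (h : A →+* K) (hh : Function.Injective h)
    (g : A →+* L) (P : V → Fin 2 → A) (PK : V → Fin 2 → K) (PL : V → Fin 2 → L)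
    (hK : ∀ v i, h (P v i) = PK v i) (hL : ∀ v i, g (P v i) = PL v i)
    (f : MvPolynomial (Fin n) ℤ) (e : ℕ)
    (hf : 2 * MvPolynomial.aeval (fun j => triangleArea fun i => PK (T.tri j i)) f =
      (∑ j, triangleArea fun i => PK (T.tri j i)) ^ e) :
    2 * MvPolynomial.aeval (fun j => triangleArea fun i => PL (T.tri j i)) f =
      (∑ j, triangleArea fun i => PL (T.tri j i)) ^ e := by
  obtain rfl : algK = Ring.toIntAlgebra K := Subsingleton.elim _ _
  obtain rfl : algL = Ring.toIntAlgebra L := Subsingleton.elim _ _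
  obtain rfl : (fun v i => h (P v i)) = PK := funext₂ hK
  obtain rfl : (fun v i => g (P v i)) = PL := funext₂ hL
  simp_rw [triangleArea_map, ← map_sum] at hf ⊢
  set z : Fin n → A := fun j => algebraMap ℚ A (1 / 2) *
    ∑ i, planeCross (P (T.tri j i)) (P (T.tri j (i + 1)))
  have hh' := MvPolynomial.comp_aeval_apply (R := ℤ) z h.toIntAlgHom f
  have hg' := MvPolynomial.comp_aeval_apply (R := ℤ) z g.toIntAlgHom f
  simp only [RingHom.toIntAlgHom_apply] at hh' hg'
  rw [← hh'] at hf
  rw [← hg']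
  -- Injectivity of `h` brings the identity down to `A`; `g` need not be defined on `K`.
  have key : 2 * MvPolynomial.aeval z f = (∑ j, z j) ^ e :=
    hh (by rw [map_mul, map_ofNat, hf, map_pow])
  rw [← map_pow, ← key, map_mul, map_ofNat]

/-! ### Specialization of the corners -/

theorem fixedCoord_p : T.fixedCoord T.p = ![0, 0] := by
  simp [fixedCoord]

theorem fixedCoord_q : T.fixedCoord T.q = ![1, 0] := by
  simp [fixedCoord, T.corner_injective.eq_iff]

theorem fixedCoord_r : T.fixedCoord T.r = ![1, 1] := by
  simp [fixedCoord, T.corner_injective.eq_iff]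

theorem fixedCoord_s : T.fixedCoord T.s = ![0, 1] := by
  simp [fixedCoord, T.corner_injective.eq_iff]

open Classical in
/-- The generic coordinates of the vertices, as polynomials. -/
noncomputable def polyCoord (v : V) (i : Fin 2) : MvPolynomial ({v : V // v ≠ T.r} × Fin 2) ℚ :=
  if h : v ≠ T.r then MvPolynomial.X (⟨v, h⟩, i)
  else MvPolynomial.X (⟨T.q, T.q_ne_r⟩, i) + MvPolynomial.X (⟨T.s, T.s_ne_r⟩, i) -
    MvPolynomial.X (⟨T.p, T.p_ne_r⟩, i)

theorem algebraMap_polyCoord (v : V) (i : Fin 2) :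
    algebraMap _ T.FunctionField (T.polyCoord v i) = T.coord v i := by
  unfold polyCoord coord coordVar
  split_ifs <;> simp

/-- The homomorphism that places the corners at the vertices of the unit square. -/
noncomputable def fixCorners : MvPolynomial ({v : V // v ≠ T.r} × Fin 2) ℚ →ₐ[ℚ] T.FixedCornerField :=
  MvPolynomial.aeval fun x => T.fixedCoord x.1 x.2

theorem fixCorners_polyCoord (v : V) (i : Fin 2) :
    T.fixCorners (T.polyCoord v i) = T.fixedCoord v i := by
  unfold polyCoord fixCorners
  split_ifs with h
  · simp
  · rw [not_not] at h
    subst h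
    simp only [map_add, map_sub, MvPolynomial.aeval_X, fixedCoord_p, fixedCoord_q, fixedCoord_r,
      fixedCoord_s]
    fin_cases i <;> simp

theorem sum_fixedZ : ∑ j, T.fixedZ j = 1 := by
  have : CharZero T.FixedCornerField := algebraRat.charZero _
  exact T.sum_triangleArea_eq_one T.fixedCoord_p T.fixedCoord_q T.fixedCoord_r T.fixedCoord_s

theorem two_mul_aeval_fixedZ {f : MvPolynomial (Fin n) ℤ} {e : ℕ}
    (hf : 2 * MvPolynomial.aeval T.Z f = T.σ ^ e) : 2 * MvPolynomial.aeval T.fixedZ f = 1 := by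
  have h := T.two_mul_aeval_transfer
    (algebraMap (MvPolynomial ({v : V // v ≠ T.r} × Fin 2) ℚ) T.FunctionField)
    (IsFractionRing.injective _ _) T.fixCorners.toRingHom T.polyCoord T.coord T.fixedCoord
    T.algebraMap_polyCoord T.fixCorners_polyCoord f e hf
  change _ = (∑ j, T.fixedZ j) ^ e at h
  rwa [sum_fixedZ, one_pow] at h

/-! ### Affine normalization of the corners -/

open Classical in
/-- The generic coordinates of the vertices of a drawing with fixed corners, as polynomials. -/
noncomputable def fixedPolyCoord (v : V) : Fin 2 → MvPolynomial (T.InteriorVertex × Fin 2) ℚ :=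
  if h : v ∉ Set.range T.corner then fun i => MvPolynomial.X (⟨v, h⟩, i)
  else if v = T.p then ![0, 0]
  else if v = T.q then ![1, 0]
  else if v = T.r then ![1, 1]
  else ![0, 1]

theorem algebraMap_fixedPolyCoord (v : V) (i : Fin 2) :
    algebraMap _ T.FixedCornerField (T.fixedPolyCoord v i) = T.fixedCoord v i := by
  unfold fixedPolyCoord fixedCoord
  by_cases h : v ∈ Set.range T.corner
  · simp only [h, not_true_eq_false, dite_false]
    split_ifs <;> fin_cases i <;> simp
  · simp [h]

theorem coord_r : T.coord T.r = T.coord T.q + T.coord T.s - T.coord T.p := by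
  ext i
  simp [coord, T.p_ne_r, T.q_ne_r, T.s_ne_r]

theorem σ_eq : T.σ = planeCross (T.coord T.q - T.coord T.p) (T.coord T.s - T.coord T.p) := by
  have : CharZero T.FunctionField := algebraRat.charZero _
  refine (T.sum_triangleArea T.coord).trans ?_
  simp only [Fin.sum_univ_four, Fin.isValue, zero_add, Fin.reduceAdd, coord_r, planeCross,
    Pi.add_apply, Pi.sub_apply]
  ring

/-- It suffices that one specialization, the unit square, gives `σ` the value 1. -/
theorem σ_ne_zero : T.σ ≠ 0 := by
  let d := planeCross (T.polyCoord T.q - T.polyCoord T.p) (T.polyCoord T.s - T.polyCoord T.p)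
  have h1 : algebraMap _ T.FunctionField d = T.σ := by
    simp [d, σ_eq, planeCross, algebraMap_polyCoord]
  have h2 : T.fixCorners d = 1 := by
    simp [d, planeCross, fixCorners_polyCoord, fixedCoord_p, fixedCoord_q, fixedCoord_s]
  rw [← h1, Ne, IsFractionRing.to_map_eq_zero_iff]
  intro h
  simp [h] at h2

/-- The coordinates in the affine frame that puts the corners at the vertices of the unit
square. -/
noncomputable def normalizedCoord (v : V) : Fin 2 → T.FunctionField :=
  ![planeCross (T.coord v - T.coord T.p) (T.coord T.s - T.coord T.p) / T.σ,
    planeCross (T.coord T.q - T.coord T.p) (T.coord v - T.coord T.p) / T.σ]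

/-- By Cramer's rule these are the coordinates of `v - p` in the basis `q - p`, `s - p`, whose
determinant is `σ`. -/
theorem normalizedCoord_corner (i : Fin 4) :
    T.normalizedCoord (T.corner i) = ![![0, 0], ![1, 0], ![1, 1], ![0, 1]] i := by
  have hσ := T.σ_ne_zero
  have hσ' := T.σ_eq
  have hr : T.coord T.r - T.coord T.p =
      (T.coord T.q - T.coord T.p) + (T.coord T.s - T.coord T.p) := by
    rw [coord_r]; abel
  unfold normalizedCoord
  fin_cases i
  · simp [planeCross]
  · change ![planeCross (T.coord T.q - T.coord T.p) _ / _, planeCross _ (T.coord T.q - _) / _] = _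
    simp [planeCross_self, ← hσ', hσ]
  · change ![planeCross (T.coord T.r - T.coord T.p) _ / _, planeCross _ (T.coord T.r - _) / _] = _
    simp [hr, planeCross_add_self, planeCross_self_add, ← hσ', hσ]
  · change ![planeCross (T.coord T.s - T.coord T.p) _ / _, planeCross _ (T.coord T.s - _) / _] = _
    simp [planeCross_self, ← hσ', hσ]

theorem triangleArea_normalizedCoord (j : Fin n) :
    triangleArea (fun i => T.normalizedCoord (T.tri j i)) = T.σ⁻¹ * T.Z j := by
  have : CharZero T.FunctionField := algebraRat.charZero _
  have hσ := T.σ_ne_zero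
  rw [← mul_right_inj' (two_ne_zero' T.FunctionField), mul_left_comm, Z, two_mul_triangleArea,
    two_mul_triangleArea]
  simp only [normalizedCoord, Matrix.cons_val]
  field_simp
  rw [σ_eq]
  simp only [planeCross, Pi.sub_apply]
  ring

/-- The homomorphism that sends a drawing with fixed corners to the affine normalization of the
generic drawing. -/
noncomputable def normalize : MvPolynomial (T.InteriorVertex × Fin 2) ℚ →ₐ[ℚ] T.FunctionField :=
  MvPolynomial.aeval fun x => T.normalizedCoord x.1 x.2

theorem normalize_fixedPolyCoord (v : V) (i : Fin 2) :
    T.normalize (T.fixedPolyCoord v i) = T.normalizedCoord v i := by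
  by_cases h : v ∈ Set.range T.corner
  · obtain ⟨k, rfl⟩ := h
    rw [normalizedCoord_corner]
    fin_cases k <;> fin_cases i <;> simp [fixedPolyCoord, T.corner_injective.eq_iff]
  · simp [fixedPolyCoord, h, normalize]

theorem two_mul_aeval_Z {f : MvPolynomial (Fin n) ℤ} {e : ℕ} (hfe : f.IsHomogeneous e)
    (hf : 2 * MvPolynomial.aeval T.fixedZ f = 1) : 2 * MvPolynomial.aeval T.Z f = T.σ ^ e := by
  -- The transported right-hand side is 1, hence exponent 0; the power `σ ^ e` comes from pulling
  -- `σ⁻¹` out of `f`.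
  have h := T.two_mul_aeval_transfer
    (algebraMap (MvPolynomial (T.InteriorVertex × Fin 2) ℚ) T.FixedCornerField)
    (IsFractionRing.injective _ _) T.normalize.toRingHom T.fixedPolyCoord T.fixedCoord
    T.normalizedCoord T.algebraMap_fixedPolyCoord T.normalize_fixedPolyCoord f 0
    (hf.trans (pow_zero _).symm)
  simp only [triangleArea_normalizedCoord, pow_zero] at h
  rw [hfe.aeval_mul_left, inv_pow, mul_left_comm,
    inv_mul_eq_one₀ (pow_ne_zero e T.σ_ne_zero)] at h
  exact h.symm

end SquareTriangulation

theorem mainTheorem10 {V : Type*} [Fintype V] {n : ℕ} (T : SquareTriangulation V n) :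
    -- a homogeneous integer polynomial with `2 f = 1` in the fixed-corner function field exists
    (∃ (f : MvPolynomial (Fin n) ℤ) (e : ℕ),
      f.IsHomogeneous e ∧ 2 * MvPolynomial.aeval T.fixedZ f = 1) ∧
    -- every Monsky polynomial is one
    (∀ f : MvPolynomial (Fin n) ℤ,
      T.IsMonskyPolynomial f → 2 * MvPolynomial.aeval T.fixedZ f = 1) ∧
    -- conversely, each of them is a Monsky polynomial, with exponent its degree
    (∀ (f : MvPolynomial (Fin n) ℤ) (e : ℕ),
      f.IsHomogeneous e → 2 * MvPolynomial.aeval T.fixedZ f = 1 →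
        T.IsMonskyPolynomial f ∧ 2 * MvPolynomial.aeval T.Z f = T.σ ^ e) := by
  have : CharZero T.FixedCornerField := algebraRat.charZero _
  refine ⟨T.exists_isHomogeneous_two_mul_aeval_eq_one T.fixedCoord_p T.fixedCoord_q
    T.fixedCoord_r T.fixedCoord_s, fun f hf => ?_, fun f e hfe hf => ?_⟩
  · obtain ⟨-, e, he⟩ := hf
    exact T.two_mul_aeval_fixedZ he
  · have h := T.two_mul_aeval_Z hfe hf
    exact ⟨⟨⟨e, hfe⟩, e, h⟩, h⟩
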